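/- Let $P\neq Q$ be probability measures on a measurable space $\mathcal X$ (for instance $\mathcal X\subseteq\mathbb R^d$), let $h:\mathcal X\to\mathbb R$ be a fixed measurable function (the witness), and let $\alpha\in(0,1)$. Given independent samples $x_1,\dots,x_n$ i.i.d. from $P$ and $y_1,\dots,y_m$ i.i.d. from $Q$, put $\hat c=\frac{n}{n+m}$, let $\hat h_P=\frac1n\sum_{i=1}^n h(x_i)$ and $\hat h_Q=\frac1m\sum_{j=1}^m h(y_j)$ be the empirical means, let $\hat\sigma_P^2$, $\hat\sigma_Q^2$ be the sample variances of $h(x_1),\dots,h(x_n)$ and of $h(y_1),\dots,h(y_m)$ (normalised either both by sample size, or both by sample size minus one), and let $$\tau=\sqrt{n+m}\;\frac{\hat h_P-\hat h_Q}{\hat\sigma_{\hat c}(h)},\qquad \hat\sigma_{\hat c}^2(h)=\frac{\hat\sigma_P^2}{\hat c}+\frac{\hat\sigma_Q^2}{1-\hat c}.$$ The one-sided witness two-sample (WiTS) test based on $h$ rejects the null hypothesis $P=Q$ if $\tau>\Phi^{-1}(1-\alpha)$, where $\Phi$ is the standard normal distribution function (with the convention $\tau=0$ when $\hat\sigma_{\hat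 c}(h)=0$). Let $(n_k)$, $(m_k)$ be sequences of sample sizes with $n_k+m_k\to\infty$ and $\frac{n_k}{n_k+m_k}\to c$ for some $c\in(0,1)$, and assume that $$\sigma_c(h):=\sqrt{\frac{\operatorname{Var}_P[h]}{c}+\frac{\operatorname{Var}_Q[h]}{1-c}}$$ satisfies $0<\sigma_c(h)<\infty$. Then the test is consistent against the fixed alternative $(P,Q)$, that is, the probability that it rejects on samples of sizes $(n_k,m_k)$ tends to $1$ as $k\to\infty$, if and only if $\mathbb E_P[h]>\mathbb E_Q[h]$. -/

import Mathlib

open MeasureTheory ProbabilityTheory Filter Topology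
open scoped ENNReal

namespace WiTS

noncomputable section

variable {𝒳 : Type*}

/-- Standard normal quantile function: for `0 < p < 1` this is the inverse at `p` of the
standard normal cumulative distribution function. -/
def stdNormalQuantile (p : ℝ) : ℝ := sInf {t : ℝ | p ≤ cdf (gaussianReal 0 1) t}

/-- Empirical mean of `h` over the sample `x`. -/
def empMean (h : 𝒳 → ℝ) {n : ℕ} (x : Fin n → 𝒳) : ℝ := (∑ i, h (x i)) / n

/-- Sample variance of `h` over the sample `x`, normalised by `n - r`: `r = 0` is the
plug-in estimator, `r = 1` the unbiased one. -/
def sampleVar (r : ℕ) (h : 𝒳 → ℝ) {n : ℕ} (x : Fin n → 𝒳) : ℝ :=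
  (∑ i, (h (x i) - empMean h x) ^ 2) / ((n : ℝ) - r)

/-- Pooled empirical standard deviation, with `c = n / (n + m)`. -/
def pooledSampleSD (r : ℕ) (h : 𝒳 → ℝ) {n m : ℕ} (x : Fin n → 𝒳) (y : Fin m → 𝒳) : ℝ :=
  let c : ℝ := (n : ℝ) / ((n : ℝ) + m)
  √(sampleVar r h x / c + sampleVar r h y / (1 - c))

/-- The standardized difference of the empirical means of the witness `h`. -/
def statistic (r : ℕ) (h : 𝒳 → ℝ) {n m : ℕ} (x : Fin n → 𝒳) (y : Fin m → 𝒳) : ℝ :=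
  √((n : ℝ) + m) * ((empMean h x - empMean h y) / pooledSampleSD r h x y)

/-- A two-sample test: for all sample sizes, whether the null hypothesis is rejected. -/
abbrev TwoSampleTest (𝒳 : Type*) := ∀ n m : ℕ, (Fin n → 𝒳) → (Fin m → 𝒳) → Prop

/-- The one-sided witness two-sample test based on `h`, with the asymptotic threshold at
significance level `α`. -/
def witnessTest (r : ℕ) (h : 𝒳 → ℝ) (α : ℝ) : TwoSampleTest 𝒳 :=
  fun _ _ x y ↦ stdNormalQuantile (1 - α) < statistic r h x y

variable [MeasurableSpace 𝒳]

/-- Probability that the test rejects on `n` i.i.d. draws from `P` and `m` independent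
i.i.d. draws from `Q`. -/
def power (T : TwoSampleTest 𝒳) (P Q : Measure 𝒳) (n m : ℕ) : ℝ :=
  ((Measure.pi fun _ : Fin n ↦ P).prod (Measure.pi fun _ : Fin m ↦ Q)).real
    {z | T n m z.1 z.2}

/-- The test is consistent against `(P, Q)` along the sample sizes `(n k, m k)`. -/
def IsConsistentAgainst (T : TwoSampleTest 𝒳) (P Q : Measure 𝒳) (n m : ℕ → ℕ) : Prop :=
  Tendsto (fun k ↦ power T P Q (n k) (m k)) atTop (𝓝 1)

/-- Pooled population standard deviation `√(Var_P[h] / c + Var_Q[h] / (1 - c))`, in `[0, ∞]`. -/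
def pooledSD (h : 𝒳 → ℝ) (P Q : Measure 𝒳) (c : ℝ) : ℝ≥0∞ :=
  (evariance h P / ENNReal.ofReal c + evariance h Q / ENNReal.ofReal (1 - c)) ^ (1 / 2 : ℝ)

end

end WiTS

/-! All sample sizes are realised at once as initial segments of two independent i.i.d. sequences,
so almost sure limits make sense. If `E_P h > E_Q h`, the strong law for `h` and `h ^ 2` makes the
mean difference and the pooled deviation converge to positive limits; the factor `√(n + m)` then
drives the statistic past any threshold (`ae_tendsto_statistic_atTop`).

If `E_P h ≤ E_Q h`, acceptance keeps a probability bounded away from `0`. By the central limit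
theorem each sample's scaled mean deviation is, with probability at least some `δ > 0`, far enough
in the unfavourable direction. Independence multiplies the two bounds, so no joint limit law is
needed. -/

namespace WiTS

variable {𝒳 : Type*}

/-- The first `n` terms of a sequence. -/
def initialSample (n : ℕ) (ω : ℕ → 𝒳) : Fin n → 𝒳 := fun i ↦ ω i

/-! ### Deterministic identities and inequalities -/

lemma empMean_initialSample (h : 𝒳 → ℝ) (n : ℕ) (ω : ℕ → 𝒳) :
    empMean h (initialSample n ω) = (∑ i ∈ Finset.range n, h (ω i)) / n := by
  simp only [empMean, initialSample]
  rw [Fin.sum_univ_eq_sum_range (fun i ↦ h (ω i))]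

lemma sampleVar_eq (r : ℕ) (h : 𝒳 → ℝ) {n : ℕ} (hn : n ≠ 0) (x : Fin n → 𝒳) :
    sampleVar r h x = (empMean (fun x ↦ h x ^ 2) x - empMean h x ^ 2) * (n / ((n : ℝ) - r)) := by
  have hn' : (n : ℝ) ≠ 0 := by exact_mod_cast hn
  have hsum : ∑ i, h (x i) = n * empMean h x := by
    rw [empMean]; field_simp
  have hsq : ∑ i, h (x i) ^ 2 = n * empMean (fun x ↦ h x ^ 2) x := by
    rw [empMean]; field_simp
  have : ∑ i, (h (x i) - empMean h x) ^ 2 =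
      n * (empMean (fun x ↦ h x ^ 2) x - empMean h x ^ 2) := by
    simp only [sub_sq, Finset.sum_add_distrib, Finset.sum_sub_distrib, ← Finset.sum_mul,
      ← Finset.mul_sum, hsum, hsq]
    simp
    ring
  rw [sampleVar, this]
  ring

/-- Since `d` is forced to be nonpositive, a larger factor only lowers the product. This trades `√n`
or `√m` for `√(n + m)`. -/
lemma sqrt_mul_le_of_sqrt_mul_le {s t d a : ℝ} (hs : 0 < s) (hst : s ≤ t) (ha : a ≤ 0)
    (hd : √s * d ≤ a) : √t * d ≤ a := by
  have hd0 : d ≤ 0 := by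
    by_contra! hpos
    exact (mul_pos (Real.sqrt_pos.2 hs) hpos).not_ge (hd.trans ha)
  exact (mul_le_mul_of_nonpos_right (Real.sqrt_le_sqrt hst) hd0).trans hd

/-- The mean difference splits into the two deviations plus `μ - ν ≤ 0`. The bound uses `|q|`
because the quantile may have either sign. -/
lemma statistic_le_of_empMean_le {r : ℕ} {h : 𝒳 → ℝ} {n m : ℕ} {x : Fin n → 𝒳} {y : Fin m → 𝒳}
    {μ ν a b S q : ℝ} (hn : 0 < n) (hm : 0 < m) (ha : a ≤ 0) (hb : b ≤ 0) (hμν : μ ≤ ν)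
    (hx : √n * (empMean h x - μ) ≤ a) (hy : √m * (ν - empMean h y) ≤ b)
    (hs : 0 < pooledSampleSD r h x y) (hsS : pooledSampleSD r h x y ≤ S)
    (hq : a + b ≤ -(|q| * S)) : statistic r h x y ≤ q := by
  have hn' : (0 : ℝ) < n := by exact_mod_cast hn
  have hm' : (0 : ℝ) < m := by exact_mod_cast hm
  have h₁ := sqrt_mul_le_of_sqrt_mul_le hn' (le_add_of_nonneg_right hm'.le) ha hx
  have h₂ := sqrt_mul_le_of_sqrt_mul_le hm' (le_add_of_nonneg_left hn'.le) hb hy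
  have h₃ : √((n : ℝ) + m) * (empMean h x - empMean h y) ≤ a + b := by
    have := mul_nonneg (Real.sqrt_nonneg ((n : ℝ) + m)) (sub_nonneg.2 hμν)
    linarith
  rw [statistic, ← mul_div_assoc, div_le_iff₀ hs]
  calc √((n : ℝ) + m) * (empMean h x - empMean h y) ≤ -(|q| * S) := h₃.trans hq
    _ ≤ -(|q| * pooledSampleSD r h x y) :=
      neg_le_neg (mul_le_mul_of_nonneg_left hsS (abs_nonneg q))
    _ = -|q| * pooledSampleSD r h x y := (neg_mul _ _).symm
    _ ≤ q * pooledSampleSD r h x y := mul_le_mul_of_nonneg_right (neg_abs_le q) hs.le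

variable [MeasurableSpace 𝒳]

/-! ### Infinite sample sequences and measurability -/

lemma measurePreserving_initialSample (P : Measure 𝒳) [IsProbabilityMeasure P] (n : ℕ) :
    MeasurePreserving (initialSample n) (Measure.infinitePi fun _ : ℕ ↦ P)
      (Measure.pi fun _ : Fin n ↦ P) where
  measurable := measurable_pi_lambda _ fun i ↦ measurable_pi_apply (i : ℕ)
  map_eq := by
    rw [← Measure.infinitePi_eq_pi]
    exact Measure.map_infinitePi_infinitePi_of_inj (P := fun _ : ℕ ↦ P) Fin.val_injective

lemma measurable_initialSample (n : ℕ) :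
    Measurable (initialSample n : (ℕ → 𝒳) → Fin n → 𝒳) :=
  measurable_pi_lambda _ fun i ↦ measurable_pi_apply (i : ℕ)

lemma measurable_empMean {h : 𝒳 → ℝ} (hh : Measurable h) (n : ℕ) :
    Measurable (empMean h : (Fin n → 𝒳) → ℝ) := by
  unfold empMean
  fun_prop

lemma measurable_sampleVar {h : 𝒳 → ℝ} (hh : Measurable h) (r n : ℕ) :
    Measurable (sampleVar r h : (Fin n → 𝒳) → ℝ) := by
  have := measurable_empMean hh n
  unfold sampleVar
  fun_prop

lemma measurable_pooledSampleSD {h : 𝒳 → ℝ} (hh : Measurable h) (r n m : ℕ) :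
    Measurable fun z : (Fin n → 𝒳) × (Fin m → 𝒳) ↦ pooledSampleSD r h z.1 z.2 := by
  have h₁ := (measurable_sampleVar hh r n).comp
    (measurable_fst : Measurable (Prod.fst : (Fin n → 𝒳) × (Fin m → 𝒳) → _))
  have h₂ := (measurable_sampleVar hh r m).comp
    (measurable_snd : Measurable (Prod.snd : (Fin n → 𝒳) × (Fin m → 𝒳) → _))
  exact ((h₁.div_const _).add (h₂.div_const _)).sqrt

lemma measurable_statistic {h : 𝒳 → ℝ} (hh : Measurable h) (r n m : ℕ) :
    Measurable fun z : (Fin n → 𝒳) × (Fin m → 𝒳) ↦ statistic r h z.1 z.2 := by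
  have h₁ := (measurable_empMean hh n).comp
    (measurable_fst : Measurable (Prod.fst : (Fin n → 𝒳) × (Fin m → 𝒳) → _))
  have h₂ := (measurable_empMean hh m).comp
    (measurable_snd : Measurable (Prod.snd : (Fin n → 𝒳) × (Fin m → 𝒳) → _))
  exact ((h₁.sub h₂).div (measurable_pooledSampleSD hh r n m)).const_mul _

/-! ### Limit theorems for a single sample -/

lemma identDistrib_comp_eval (P : Measure 𝒳) [IsProbabilityMeasure P] {h : 𝒳 → ℝ}
    (hh : Measurable h) (i : ℕ) :
    IdentDistrib (fun ω : ℕ → 𝒳 ↦ h (ω i)) h (Measure.infinitePi fun _ : ℕ ↦ P) P where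
  aemeasurable_fst := (hh.comp (measurable_pi_apply i)).aemeasurable
  aemeasurable_snd := hh.aemeasurable
  map_eq := by
    conv_rhs => rw [← (measurePreserving_eval_infinitePi (fun _ : ℕ ↦ P) i).map_eq,
      Measure.map_map hh (measurable_pi_apply i)]
    rfl

lemma ae_tendsto_empMean (P : Measure 𝒳) [IsProbabilityMeasure P] {h : 𝒳 → ℝ}
    (hh : Measurable h) (hint : Integrable h P) :
    ∀ᵐ ω ∂Measure.infinitePi fun _ : ℕ ↦ P,
      Tendsto (fun n ↦ empMean h (initialSample n ω)) atTop (𝓝 (∫ x, h x ∂P)) := by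
  have hid := identDistrib_comp_eval P hh
  have key := strong_law_ae_real (fun i (ω : ℕ → 𝒳) ↦ h (ω i))
    ((hid 0).integrable_iff.2 hint)
    (fun i j hij ↦ (iIndepFun_infinitePi (P := fun _ : ℕ ↦ P)
      (X := fun _ ↦ h) fun _ ↦ hh).indepFun hij)
    fun i ↦ (hid i).trans (hid 0).symm
  rw [(hid 0).integral_eq] at key
  simpa only [empMean_initialSample] using key

lemma ae_tendsto_sampleVar (P : Measure 𝒳) [IsProbabilityMeasure P] {h : 𝒳 → ℝ}
    (hh : Measurable h) (hL2 : MemLp h 2 P) (r : ℕ) :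
    ∀ᵐ ω ∂Measure.infinitePi fun _ : ℕ ↦ P,
      Tendsto (fun n ↦ sampleVar r h (initialSample n ω)) atTop (𝓝 Var[h; P]) := by
  filter_upwards [ae_tendsto_empMean P hh (hL2.integrable one_le_two),
    ae_tendsto_empMean P (hh.pow_const 2) hL2.integrable_sq] with ω h₁ h₂
  have h₃ : Tendsto (fun n : ℕ ↦ (n : ℝ) / ((n : ℝ) - r)) atTop (𝓝 1) := by
    simpa [sub_eq_add_neg] using tendsto_natCast_div_add_atTop (-(r : ℝ))
  have h₄ := (h₂.sub (h₁.pow 2)).mul h₃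
  rw [mul_one] at h₄
  rw [variance_eq_sub hL2]
  refine h₄.congr' ?_
  filter_upwards [eventually_ne_atTop 0] with n hn
  exact (sampleVar_eq r h hn _).symm

/-- Central limit theorem plus the portmanteau inequality for an open half-line; `δ` is any value
strictly between `0` and its Gaussian mass. -/
lemma exists_pos_le_measureReal_empMean_sub_lt (P : Measure 𝒳) [IsProbabilityMeasure P]
    {h : 𝒳 → ℝ} (hh : Measurable h) (hL2 : MemLp h 2 P) (hvar : Var[h; P] ≠ 0) (a : ℝ) :
    ∃ δ > 0, ∀ᶠ n : ℕ in atTop, δ ≤ (Measure.infinitePi fun _ : ℕ ↦ P).real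
      {ω | √n * (empMean h (initialSample n ω) - ∫ x, h x ∂P) < a} := by
  have hid := identDistrib_comp_eval P hh
  have hv := (hid 0).variance_eq
  have hv0 : Var[h; P].toNNReal ≠ 0 := by
    simpa using lt_of_le_of_ne (variance_nonneg h P) hvar.symm
  have key := tendstoInDistribution_inv_sqrt_mul_sum_sub
    (X := fun i (ω : ℕ → 𝒳) ↦ h (ω i)) (P := Measure.infinitePi fun _ : ℕ ↦ P)
    (Y := id) (P' := gaussianReal 0 Var[h; P].toNNReal)
    (by rw [hv]; exact HasLaw.id) ((hid 0).memLp_iff.2 hL2)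
    (iIndepFun_infinitePi (P := fun _ : ℕ ↦ P) (X := fun _ ↦ h) fun _ ↦ hh)
    fun i ↦ (hid i).trans (hid 0).symm
  have hlim := ProbabilityMeasure.le_liminf_measure_open_of_tendsto key.tendsto
    (isOpen_Iio (a := a))
  -- Lebesgue measure is absolutely continuous with respect to a nondegenerate Gaussian, so a null
  -- half-line would have length zero.
  have hpos : gaussianReal 0 Var[h; P].toNNReal (Set.Iio a) ≠ 0 := fun h0 ↦ by
    simpa using gaussianReal_absolutelyContinuous' 0 hv0 h0
  simp only [ProbabilityMeasure.coe_mk, Measure.map_id] at hlim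
  obtain ⟨δ, hδ0, hδ⟩ := exists_between (pos_iff_ne_zero.2 hpos)
  have hδtop : δ ≠ ∞ := hδ.ne_top
  refine ⟨δ.toReal, ENNReal.toReal_pos hδ0.ne' hδtop, ?_⟩
  filter_upwards [eventually_lt_of_lt_liminf (hδ.trans_le hlim), eventually_ne_atTop 0]
    with n hn hn0
  rw [Measure.map_apply_of_aemeasurable (key.forall_aemeasurable n) measurableSet_Iio] at hn
  refine ENNReal.toReal_mono (measure_ne_top _ _) (hn.le.trans (measure_mono fun ω hω ↦ ?_))
  have hn' : (0 : ℝ) < n := by exact_mod_cast Nat.pos_of_ne_zero hn0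
  have hω' : (√(n : ℝ))⁻¹ * (∑ k ∈ Finset.range n, h (ω k) - n * ∫ x, h x ∂P) < a := by
    rw [← (hid 0).integral_eq]; exact hω
  have heq : √(n : ℝ) * (empMean h (initialSample n ω) - ∫ x, h x ∂P) =
      (√(n : ℝ))⁻¹ * (∑ k ∈ Finset.range n, h (ω k) - n * ∫ x, h x ∂P) := by
    rw [empMean_initialSample]
    have := Real.sq_sqrt hn'.le
    have := (Real.sqrt_pos.2 hn').ne'
    field_simp
    linear_combination (∑ k ∈ Finset.range n, h (ω k) - n * ∫ x, h x ∂P) * ‹√(n : ℝ) ^ 2 = n›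
  exact heq.trans_lt hω'

/-- Zero variance makes `h` almost surely constant and the deviation exactly `0`, hence the
alternative `0 ≤ a`. -/
lemma exists_pos_le_measureReal_empMean_sub_le (P : Measure 𝒳) [IsProbabilityMeasure P]
    {h : 𝒳 → ℝ} (hh : Measurable h) (hL2 : MemLp h 2 P) {a : ℝ}
    (ha : Var[h; P] ≠ 0 ∨ 0 ≤ a) :
    ∃ δ > 0, ∀ᶠ n : ℕ in atTop, δ ≤ (Measure.infinitePi fun _ : ℕ ↦ P).real
      {ω | √n * (empMean h (initialSample n ω) - ∫ x, h x ∂P) ≤ a} := by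
  by_cases hvar : Var[h; P] = 0
  · have ha' : 0 ≤ a := ha.resolve_left (not_not.2 hvar)
    refine ⟨1, one_pos, (eventually_ne_atTop 0).mono fun n hn ↦ ?_⟩
    have hconst : ∀ᵐ ω ∂Measure.infinitePi fun _ : ℕ ↦ P, ∀ i : ℕ, h (ω i) = ∫ x, h x ∂P :=
      ae_all_iff.2 fun i ↦ (measurePreserving_eval_infinitePi (fun _ : ℕ ↦ P)
        i).quasiMeasurePreserving.ae (ae_eq_integral_of_variance_eq_zero hL2 hvar)
    have hae : ∀ᵐ ω ∂Measure.infinitePi fun _ : ℕ ↦ P,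
        √n * (empMean h (initialSample n ω) - ∫ x, h x ∂P) ≤ a := by
      filter_upwards [hconst] with ω hω
      simp [empMean_initialSample, hω, hn, ha']
    rw [measureReal_congr (eventuallyEq_univ.2 hae), probReal_univ]
  · obtain ⟨δ, hδ, hev⟩ := exists_pos_le_measureReal_empMean_sub_lt P hh hL2 hvar a
    exact ⟨δ, hδ, hev.mono fun n hn ↦ hn.trans (measureReal_mono fun ω hω ↦ show _ ≤ a from le_of_lt hω)⟩

lemma tendsto_measureReal_of_ae_eventually_mem {Ω : Type*} [MeasurableSpace Ω] {μ : Measure Ω}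
    [IsProbabilityMeasure μ] {A : ℕ → Set Ω} (hA : ∀ k, MeasurableSet (A k))
    (hmem : ∀ᵐ ω ∂μ, ∀ᶠ k in atTop, ω ∈ A k) :
    Tendsto (fun k ↦ μ.real (A k)) atTop (𝓝 1) := by
  have key := tendsto_measure_of_ae_tendsto_indicator_of_isFiniteMeasure atTop (μ := μ)
    MeasurableSet.univ hA (hmem.mono fun ω hω ↦ hω.mono fun k hk ↦ by simpa using hk)
  rw [measure_univ] at key
  exact (ENNReal.tendsto_toReal ENNReal.one_ne_top).comp key

/-! ### Two samples: power, pooled deviation and sample sizes -/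

/-- The law of a pair of independent i.i.d. sequences with marginals `P` and `Q`. -/
noncomputable abbrev sequenceLaw (P Q : Measure 𝒳) : Measure ((ℕ → 𝒳) × (ℕ → 𝒳)) :=
  (Measure.infinitePi fun _ : ℕ ↦ P).prod (Measure.infinitePi fun _ : ℕ ↦ Q)

/-- The sequences on whose initial samples the witness test rejects. -/
def rejectionSet (r : ℕ) (h : 𝒳 → ℝ) (α : ℝ) (n m : ℕ) : Set ((ℕ → 𝒳) × (ℕ → 𝒳)) :=
  {ω | stdNormalQuantile (1 - α) < statistic r h (initialSample n ω.1) (initialSample m ω.2)}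

lemma measurable_initialSample_prod (n m : ℕ) :
    Measurable fun ω : (ℕ → 𝒳) × (ℕ → 𝒳) ↦ (initialSample n ω.1, initialSample m ω.2) :=
  ((measurable_initialSample n).comp measurable_fst).prodMk
    ((measurable_initialSample m).comp measurable_snd)

lemma measurableSet_rejectionSet {h : 𝒳 → ℝ} (hh : Measurable h) (r : ℕ) (α : ℝ) (n m : ℕ) :
    MeasurableSet (rejectionSet r h α n m) := by
  have hreject : MeasurableSet {z : (Fin n → 𝒳) × (Fin m → 𝒳) |
      stdNormalQuantile (1 - α) < statistic r h z.1 z.2} :=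
    measurableSet_lt measurable_const (measurable_statistic hh r n m)
  exact measurable_initialSample_prod n m hreject

lemma power_witnessTest (P Q : Measure 𝒳) [IsProbabilityMeasure P] [IsProbabilityMeasure Q]
    {h : 𝒳 → ℝ} (hh : Measurable h) (r : ℕ) (α : ℝ) (n m : ℕ) :
    power (witnessTest r h α) P Q n m = (sequenceLaw P Q).real (rejectionSet r h α n m) := by
  have hmp := (measurePreserving_initialSample P n).prod (measurePreserving_initialSample Q m)
  exact (hmp.measureReal_preimage
    (measurableSet_lt measurable_const (measurable_statistic hh r n m)).nullMeasurableSet).symm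

lemma memLp_two_of_pooledSD_lt_top {h : 𝒳 → ℝ} (hh : Measurable h) (P Q : Measure 𝒳)
    [IsProbabilityMeasure P] [IsProbabilityMeasure Q] {c : ℝ}
    (hσ : pooledSD h P Q c < ∞) : MemLp h 2 P ∧ MemLp h 2 Q := by
  rw [pooledSD, ENNReal.rpow_lt_top_iff_of_pos (by norm_num), ENNReal.add_lt_top] at hσ
  constructor
  · refine (evariance_lt_top_iff_memLp hh.aestronglyMeasurable).1 (lt_top_iff_ne_top.2 fun hv ↦ ?_)
    simp [hv, ENNReal.top_div] at hσ
  · refine (evariance_lt_top_iff_memLp hh.aestronglyMeasurable).1 (lt_top_iff_ne_top.2 fun hv ↦ ?_)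
    simp [hv, ENNReal.top_div] at hσ

lemma pooledVariance_pos {h : 𝒳 → ℝ} {P Q : Measure 𝒳}
    [IsProbabilityMeasure P] [IsProbabilityMeasure Q] (hP : MemLp h 2 P) (hQ : MemLp h 2 Q)
    {c : ℝ} (hc0 : 0 < c) (hc1 : c < 1) (hσ : 0 < pooledSD h P Q c) :
    0 < Var[h; P] / c + Var[h; Q] / (1 - c) := by
  have h1c : 0 < 1 - c := sub_pos.2 hc1
  rw [pooledSD, ← hP.ofReal_variance_eq, ← hQ.ofReal_variance_eq,
    ← ENNReal.ofReal_div_of_pos hc0, ← ENNReal.ofReal_div_of_pos h1c,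
    ← ENNReal.ofReal_add (div_nonneg (variance_nonneg _ _) hc0.le)
      (div_nonneg (variance_nonneg _ _) h1c.le)] at hσ
  by_contra hle
  rw [ENNReal.ofReal_of_nonpos (not_lt.1 hle), ENNReal.zero_rpow_of_pos (by norm_num)] at hσ
  exact lt_irrefl _ hσ

lemma ae_tendsto_pooledSampleSD (P Q : Measure 𝒳) [IsProbabilityMeasure P]
    [IsProbabilityMeasure Q] {h : 𝒳 → ℝ} (hh : Measurable h) (hP : MemLp h 2 P)
    (hQ : MemLp h 2 Q) (r : ℕ) {c : ℝ} (hc0 : 0 < c) (hc1 : c < 1) {n m : ℕ → ℕ}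
    (hn : Tendsto n atTop atTop) (hm : Tendsto m atTop atTop)
    (hc : Tendsto (fun k ↦ (n k : ℝ) / ((n k : ℝ) + m k)) atTop (𝓝 c)) :
    ∀ᵐ ω ∂sequenceLaw P Q, Tendsto
      (fun k ↦ pooledSampleSD r h (initialSample (n k) ω.1) (initialSample (m k) ω.2)) atTop
      (𝓝 √(Var[h; P] / c + Var[h; Q] / (1 - c))) := by
  filter_upwards [Measure.quasiMeasurePreserving_fst.ae (ae_tendsto_sampleVar P hh hP r),
    Measure.quasiMeasurePreserving_snd.ae (ae_tendsto_sampleVar Q hh hQ r)] with ω hω₁ hω₂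
  exact (((hω₁.comp hn).div hc hc0.ne').add
    ((hω₂.comp hm).div (tendsto_const_nhds.sub hc) (sub_pos.2 hc1).ne')).sqrt

/-- `n` is the product of the ratio, with positive limit `c`, and `n + m`. -/
lemma tendsto_sampleSize_left {n m : ℕ → ℕ} {c : ℝ} (hc0 : 0 < c)
    (hnm : Tendsto (fun k ↦ n k + m k) atTop atTop)
    (hc : Tendsto (fun k ↦ (n k : ℝ) / ((n k : ℝ) + m k)) atTop (𝓝 c)) :
    Tendsto n atTop atTop := by
  rw [← tendsto_natCast_atTop_iff (R := ℝ)]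
  refine (hc.pos_mul_atTop hc0 (tendsto_natCast_atTop_atTop.comp hnm)).congr' ?_
  filter_upwards [hnm.eventually_ne_atTop 0] with k hk
  have hk' : (n k : ℝ) + m k ≠ 0 := by exact_mod_cast hk
  simp only [Function.comp_apply, Nat.cast_add]
  field_simp

lemma tendsto_sampleSize_right {n m : ℕ → ℕ} {c : ℝ} (hc1 : c < 1)
    (hnm : Tendsto (fun k ↦ n k + m k) atTop atTop)
    (hc : Tendsto (fun k ↦ (n k : ℝ) / ((n k : ℝ) + m k)) atTop (𝓝 c)) :
    Tendsto m atTop atTop := by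
  refine tendsto_sampleSize_left (m := n) (sub_pos.2 hc1) (by simpa only [add_comm] using hnm) ?_
  refine (tendsto_const_nhds.sub hc).congr' ?_
  filter_upwards [hnm.eventually_ne_atTop 0] with k hk
  have hk' : (n k : ℝ) + m k ≠ 0 := by exact_mod_cast hk
  have hk'' : (m k : ℝ) + n k ≠ 0 := by rwa [add_comm]
  field_simp
  ring

/-! ### The two directions of the equivalence -/

lemma ae_tendsto_statistic_atTop (P Q : Measure 𝒳) [IsProbabilityMeasure P]
    [IsProbabilityMeasure Q] {h : 𝒳 → ℝ} (hh : Measurable h) (hP : MemLp h 2 P)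
    (hQ : MemLp h 2 Q) (r : ℕ) {c : ℝ} (hc0 : 0 < c) (hc1 : c < 1)
    (hσ : 0 < Var[h; P] / c + Var[h; Q] / (1 - c)) {n m : ℕ → ℕ}
    (hnm : Tendsto (fun k ↦ n k + m k) atTop atTop)
    (hc : Tendsto (fun k ↦ (n k : ℝ) / ((n k : ℝ) + m k)) atTop (𝓝 c))
    (hPQ : ∫ y, h y ∂Q < ∫ x, h x ∂P) :
    ∀ᵐ ω ∂sequenceLaw P Q, Tendsto
      (fun k ↦ statistic r h (initialSample (n k) ω.1) (initialSample (m k) ω.2))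
      atTop atTop := by
  have hn := tendsto_sampleSize_left hc0 hnm hc
  have hm := tendsto_sampleSize_right hc1 hnm hc
  have hsqrt : Tendsto (fun k ↦ √((n k : ℝ) + m k)) atTop atTop := by
    refine Real.tendsto_sqrt_atTop.comp ?_
    exact_mod_cast (tendsto_natCast_atTop_atTop (R := ℝ)).comp hnm
  filter_upwards [ae_tendsto_pooledSampleSD P Q hh hP hQ r hc0 hc1 hn hm hc,
    Measure.quasiMeasurePreserving_fst.ae
      (ae_tendsto_empMean P hh (hP.integrable one_le_two)),
    Measure.quasiMeasurePreserving_snd.ae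
      (ae_tendsto_empMean Q hh (hQ.integrable one_le_two))] with ω hsd hω₁ hω₂
  have hσ' := Real.sqrt_pos.2 hσ
  exact hsqrt.atTop_mul_pos (div_pos (sub_pos.2 hPQ) hσ')
    (((hω₁.comp hn).sub (hω₂.comp hm)).div hsd hσ'.ne')

lemma isConsistentAgainst_witnessTest_of_integral_lt (P Q : Measure 𝒳) [IsProbabilityMeasure P]
    [IsProbabilityMeasure Q] {h : 𝒳 → ℝ} (hh : Measurable h) (hP : MemLp h 2 P)
    (hQ : MemLp h 2 Q) (r : ℕ) (α : ℝ) {c : ℝ} (hc0 : 0 < c) (hc1 : c < 1)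
    (hσ : 0 < Var[h; P] / c + Var[h; Q] / (1 - c)) {n m : ℕ → ℕ}
    (hnm : Tendsto (fun k ↦ n k + m k) atTop atTop)
    (hc : Tendsto (fun k ↦ (n k : ℝ) / ((n k : ℝ) + m k)) atTop (𝓝 c))
    (hPQ : ∫ y, h y ∂Q < ∫ x, h x ∂P) :
    IsConsistentAgainst (witnessTest r h α) P Q n m := by
  simp only [IsConsistentAgainst, power_witnessTest P Q hh]
  refine tendsto_measureReal_of_ae_eventually_mem
    (fun k ↦ measurableSet_rejectionSet hh r α (n k) (m k)) ?_
  filter_upwards [ae_tendsto_statistic_atTop P Q hh hP hQ r hc0 hc1 hσ hnm hc hPQ] with ω hω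
  exact hω.eventually_gt_atTop _

lemma exists_pos_le_measureReal_sub_empMean_le (P : Measure 𝒳) [IsProbabilityMeasure P]
    {h : 𝒳 → ℝ} (hh : Measurable h) (hL2 : MemLp h 2 P) {a : ℝ}
    (ha : Var[h; P] ≠ 0 ∨ 0 ≤ a) :
    ∃ δ > 0, ∀ᶠ n : ℕ in atTop, δ ≤ (Measure.infinitePi fun _ : ℕ ↦ P).real
      {ω | √n * (∫ x, h x ∂P - empMean h (initialSample n ω)) ≤ a} := by
  have key := exists_pos_le_measureReal_empMean_sub_le P (h := fun x ↦ -h x) hh.neg hL2.neg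
    (a := a) (by rwa [variance_fun_neg])
  have hneg (n : ℕ) (ω : ℕ → 𝒳) :
      empMean (fun x ↦ -h x) (initialSample n ω) - ∫ x, -h x ∂P =
        ∫ x, h x ∂P - empMean h (initialSample n ω) := by
    rw [integral_neg, empMean, empMean, Finset.sum_neg_distrib]
    ring
  simpa only [hneg] using key

lemma not_isConsistentAgainst_witnessTest_of_integral_le (P Q : Measure 𝒳)
    [IsProbabilityMeasure P] [IsProbabilityMeasure Q] {h : 𝒳 → ℝ} (hh : Measurable h)
    (hP : MemLp h 2 P) (hQ : MemLp h 2 Q) (r : ℕ) (α : ℝ) {c : ℝ} (hc0 : 0 < c) (hc1 : c < 1)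
    (hσ : 0 < Var[h; P] / c + Var[h; Q] / (1 - c)) {n m : ℕ → ℕ}
    (hnm : Tendsto (fun k ↦ n k + m k) atTop atTop)
    (hc : Tendsto (fun k ↦ (n k : ℝ) / ((n k : ℝ) + m k)) atTop (𝓝 c))
    (hPQ : ∫ x, h x ∂P ≤ ∫ y, h y ∂Q) :
    ¬ IsConsistentAgainst (witnessTest r h α) P Q n m := by
  intro hcons
  simp only [IsConsistentAgainst, power_witnessTest P Q hh] at hcons
  have hn := tendsto_sampleSize_left hc0 hnm hc
  have hm := tendsto_sampleSize_right hc1 hnm hc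
  set σ := √(Var[h; P] / c + Var[h; Q] / (1 - c))
  have hσpos : 0 < σ := Real.sqrt_pos.2 hσ
  set q := stdNormalQuantile (1 - α)
  let D (k : ℕ) : Set ((ℕ → 𝒳) × (ℕ → 𝒳)) :=
    {ω | pooledSampleSD r h (initialSample (n k) ω.1) (initialSample (m k) ω.2) ∈
      Set.Ioo 0 (2 * σ)}
  have hDmeas (k : ℕ) : MeasurableSet (D k) :=
    ((measurable_pooledSampleSD hh r (n k) (m k)).comp
      (measurable_initialSample_prod (n k) (m k))) measurableSet_Ioo
  have hD : Tendsto (fun k ↦ (sequenceLaw P Q).real (D k)) atTop (𝓝 1) := by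
    refine tendsto_measureReal_of_ae_eventually_mem hDmeas ?_
    filter_upwards [ae_tendsto_pooledSampleSD P Q hh hP hQ r hc0 hc1 hn hm hc] with ω hω
    exact hω.eventually_mem (Ioo_mem_nhds hσpos (by linarith))
  -- Only one variance need be nonzero. That sample carries the whole shift `-(|q| * (2 * σ))`; the
  -- other is asked only for deviation at most `0`.
  obtain ⟨a, b, ha, hb, hab, hPa, hQb⟩ : ∃ a b : ℝ, a ≤ 0 ∧ b ≤ 0 ∧ a + b ≤ -(|q| * (2 * σ)) ∧
      (Var[h; P] ≠ 0 ∨ 0 ≤ a) ∧ (Var[h; Q] ≠ 0 ∨ 0 ≤ b) := by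
    have hK : -(|q| * (2 * σ)) ≤ 0 := by
      have := mul_nonneg (abs_nonneg q) hσpos.le
      linarith
    by_cases hvar : Var[h; P] = 0
    · refine ⟨0, _, le_rfl, hK, (zero_add _).le, .inr le_rfl, .inl fun hvar' ↦ ?_⟩
      simp [hvar, hvar'] at hσ
    · exact ⟨_, 0, hK, le_rfl, (add_zero _).le, .inl hvar, .inr le_rfl⟩
  obtain ⟨δ₁, hδ₁, hA⟩ := exists_pos_le_measureReal_empMean_sub_le P hh hP hPa
  obtain ⟨δ₂, hδ₂, hB⟩ := exists_pos_le_measureReal_sub_empMean_le Q hh hQ hQb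
  -- On the product of the two deviation events, the test accepts unless the pooled deviation leaves
  -- `(0, 2σ)`; a union bound follows.
  have hbound : ∀ᶠ k in atTop, δ₁ * δ₂ ≤
      (1 - (sequenceLaw P Q).real (rejectionSet r h α (n k) (m k))) +
        (1 - (sequenceLaw P Q).real (D k)) := by
    filter_upwards [hn.eventually hA, hm.eventually hB, hn.eventually_gt_atTop 0,
      hm.eventually_gt_atTop 0] with k hAk hBk hnk hmk
    rw [← probReal_compl_eq_one_sub (measurableSet_rejectionSet hh r α (n k) (m k)),
      ← probReal_compl_eq_one_sub (hDmeas k)]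
    calc δ₁ * δ₂ ≤ _ := mul_le_mul hAk hBk hδ₂.le measureReal_nonneg
      _ = _ := (measureReal_prod_prod _ _).symm
      _ ≤ (sequenceLaw P Q).real ((rejectionSet r h α (n k) (m k))ᶜ ∪ (D k)ᶜ) := by
        refine measureReal_mono ?_
        rintro ω ⟨hx, hy⟩
        by_cases hω : ω ∈ D k
        · exact .inl (not_lt.2 (statistic_le_of_empMean_le hnk hmk ha hb hPQ hx hy
            hω.1 hω.2.le hab))
        · exact .inr hω
      _ ≤ _ := measureReal_union_le _ _
  -- Under consistency the right side tends to `0`, contradicting `δ₁ * δ₂ > 0`.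
  have hlim := ge_of_tendsto
    ((tendsto_const_nhds.sub hcons).add (tendsto_const_nhds.sub hD)) hbound
  have := mul_pos hδ₁ hδ₂
  linarith

end WiTS

theorem proposition2 {𝒳 : Type*} [MeasurableSpace 𝒳]
    (P Q : Measure 𝒳) [IsProbabilityMeasure P] [IsProbabilityMeasure Q] (hPQ : P ≠ Q)
    (h : 𝒳 → ℝ) (hh : Measurable h)
    (α : ℝ) (hα0 : 0 < α) (hα1 : α < 1)
    (r : ℕ) (hr : r ≤ 1)
    (c : ℝ) (hc0 : 0 < c) (hc1 : c < 1)
    (hσ0 : 0 < WiTS.pooledSD h P Q c) (hσ1 : WiTS.pooledSD h P Q c < ∞)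
    (n m : ℕ → ℕ) (hnm : Tendsto (fun k ↦ n k + m k) atTop atTop)
    (hc : Tendsto (fun k ↦ (n k : ℝ) / ((n k : ℝ) + m k)) atTop (𝓝 c)) :
    WiTS.IsConsistentAgainst (WiTS.witnessTest r h α) P Q n m ↔
      ∫ y, h y ∂Q < ∫ x, h x ∂P := by
  obtain ⟨hP, hQ⟩ := WiTS.memLp_two_of_pooledSD_lt_top hh P Q hσ1
  have hσ := WiTS.pooledVariance_pos hP hQ hc0 hc1 hσ0
  refine ⟨fun hcons ↦ ?_, WiTS.isConsistentAgainst_witnessTest_of_integral_lt P Q hh hP hQ r α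
    hc0 hc1 hσ hnm hc⟩
  by_contra! hle
  exact WiTS.not_isConsistentAgainst_witnessTest_of_integral_le P Q hh hP hQ r α
    hc0 hc1 hσ hnm hc hle hcons
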